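/- Let $X$ be a real locally convex Hausdorff topological vector space with topological dual $X^*$, let $T$ be an arbitrary index set (finite or infinite), and let $f$ and $f_t$ ($t\in T$) be lower semicontinuous proper convex functions $X\to\mathbb{R}\cup\{+\infty\}$. Put $E=\{x\in X: f_t(x)\le 0 \text{ for all } t\in T\}$ and $\mathrm{dom} f=\{x\in X: f(x)<+\infty\}$, assume $E\cap \mathrm{dom} f\neq\emptyset$, and consider the problem $(\mathrm{P})$ of minimizing $f$ over $E$, with optimal value $\inf(\mathrm{P})=\inf_{x\in E}f(x)$ and optimal solution set $\mathrm{sol}(\mathrm{P})$. Let $\mathcal{H}$ be a nonempty family of nonempty finite subsets of $T$ that is covering, i.e. $\bigcup_{H\in\mathcal{H}}H=T$. With the rule $0\times(+\infty)=0$, put $$\sup(\mathrm{D}_{\mathcal{H}})=\sup_{H\in\mathcal{H},\ \mu\in\mathbb{R}_+^H}\ \inf_{x\in X}\Big\{f(x)+\sum_{t\in H}\mu_t f_t(x)\Big\},\qquad \varphi_{\mathcal{H}}=\inf_{H\in\mathcal{H},\ \mu\in\mathbb{R}_+^H}\Big(f+\sum_{t\in H}\mu_t f_t\Big)^*:X^*\to\overline{\mathbb{R}},$$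 where $h^*(x^*)=\sup_{x\in X}(\langle x^*,x\rangle-h(x))$ is the conjugate of $h$. For a lower semicontinuous proper convex function $h$ on $X$, its recession function $h_\infty$ is the function whose epigraph is the recession cone of the epigraph of $h$. Put $$(\mathrm{P})_\infty=\{x\in X: f_\infty(x)\le 0 \text{ and } (f_t)_\infty(x)\le 0 \text{ for all } t\in T\}.$$ A convex function $g:X^*\to\overline{\mathbb{R}}$ is called $\tau(X^*,X)$-quasicontinuous, where $\tau(X^*,X)$ is the Mackey topology, if the affine hull of $\mathrm{dom}\, g=\{x^*: g(x^*)<+\infty\}$ is $\tau(X^*,X)$-closed and of finite codimension, the $\tau(X^*,X)$-interior $\mathrm{ri}(\mathrm{dom}\, g)$ of $\mathrm{dom}\, g$ relative to this affine hull is nonempty, and the restriction of $g$ to the affine hull is $\tau(X^*,X)$-continuous on $\mathrm{ri}(\mathrm{dom}\, g)$. If $\varphi_{\mathcal{H}}$ is convex and $\tau(X^*,X)$-quasicontinuous and $(\mathrm{P})_\infty$ is a linear subspace of $X$, then $(\mathrm{P})$ has an optimal solution and $$\min(\mathrm{P})=\sup(\mathrm{D}_{\mathcal{H}})\in\mathbb{R}.$$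 Moreover, $\mathrm{sol}(\mathrm{P})$ is the sum of a weakly compact convex subset of $X$ and a finite-dimensional linear subspace of $X$. -/

import Mathlib

open scoped Pointwise NNReal

namespace ConvexInfinite

noncomputable section

/-! ### Extended-real-valued functions -/

/-- The epigraph of `h : E → [-∞, +∞]`, a subset of `E × ℝ`. -/
def epi {E : Type*} (h : E → EReal) : Set (E × ℝ) := {p | h p.1 ≤ (p.2 : EReal)}

/-- The (effective) domain of `h : E → [-∞, +∞]`. -/
def dom {E : Type*} (h : E → EReal) : Set E := {x | h x < ⊤}

/-- `h` is convex: its epigraph is a convex set. -/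
def IsConvexFun {E : Type*} [AddCommGroup E] [Module ℝ E] (h : E → EReal) : Prop :=
  Convex ℝ (epi h)

/-- `h ∈ Γ(X)`: `h` is a lower semicontinuous proper convex function. -/
structure IsGamma {X : Type*} [AddCommGroup X] [Module ℝ X] [TopologicalSpace X]
    (h : X → EReal) : Prop where
  convex : IsConvexFun h
  lsc : LowerSemicontinuous h
  dom_nonempty : (dom h).Nonempty
  ne_bot : ∀ x, h x ≠ ⊥

/-! ### Recession -/

/-- The recession cone `A_∞` of a convex set `A`: the directions in which one can move
indefinitely from any point of `A` without leaving `A`. -/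
def recessionCone {E : Type*} [AddCommGroup E] [Module ℝ E] (A : Set E) : Set E :=
  {d | ∀ a ∈ A, ∀ r : ℝ, 0 ≤ r → a + r • d ∈ A}

/-- The recession function `h_∞` of `h`: the function whose epigraph is the recession cone of the
epigraph of `h` (see `epi_recessionFunction`). -/
def recessionFunction {X : Type*} [AddCommGroup X] [Module ℝ X] (h : X → EReal) (x : X) : EReal :=
  ⨅ (s : ℝ) (_ : (x, s) ∈ recessionCone (epi h)), (s : EReal)

/-- The defining property of the recession function. -/
theorem epi_recessionFunction {X : Type*} [AddCommGroup X] [Module ℝ X] (h : X → EReal) :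
    epi (recessionFunction h) = recessionCone (epi h) := by
  ext ⟨x, s⟩
  constructor
  · intro hs
    rintro ⟨a, α⟩ ha r hr
    have hs' : recessionFunction h x ≤ (s : EReal) := hs
    have ha' : h a ≤ (α : EReal) := ha
    change h (a + r • x) ≤ ((α + r * s : ℝ) : EReal)
    refine EReal.le_of_forall_lt_iff_le.1 fun z hz => ?_
    have hz' : α + r * s < z := by exact_mod_cast hz
    obtain ⟨ε, hε, hεz⟩ : ∃ ε : ℝ, 0 < ε ∧ α + r * (s + ε) ≤ z := by
      refine ⟨(z - (α + r * s)) / (r + 1), by apply div_pos <;> linarith, ?_⟩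
      have h1 : r * ((z - (α + r * s)) / (r + 1)) ≤ z - (α + r * s) := by
        rw [← mul_div_assoc, div_le_iff₀ (by linarith)]
        nlinarith
      linarith
    have hlt : recessionFunction h x < ((s + ε : ℝ) : EReal) :=
      lt_of_le_of_lt hs' (by exact_mod_cast (by linarith : s < s + ε))
    simp only [recessionFunction, iInf_lt_iff] at hlt
    obtain ⟨s', hs'mem, hs'lt⟩ := hlt
    have hs'le : s' < s + ε := by exact_mod_cast hs'lt
    have key : h (a + r • x) ≤ ((α + r * s' : ℝ) : EReal) := hs'mem (a, α) ha' r hr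
    refine key.trans ?_
    have : α + r * s' ≤ z := by nlinarith
    exact_mod_cast this
  · intro hs
    exact iInf₂_le (f := fun (s : ℝ) (_ : (x, s) ∈ recessionCone (epi h)) => (s : EReal)) s hs

/-! ### The dual space with its Mackey topology -/

/-- The topological dual `X*` with the Mackey topology `τ(X*, X)`, i.e. the topology of uniform
convergence on the absolutely convex weakly compact subsets of `X`. -/
abbrev MackeyDual (X : Type*) [AddCommGroup X] [Module ℝ X] [TopologicalSpace X] :=
  UniformConvergenceCLM (RingHom.id ℝ) (E := X) ℝ
    {K : Set X | AbsConvex ℝ K ∧ IsCompact (toWeakSpace ℝ X '' K)}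

/-- The Legendre-Fenchel conjugate `h*(x*) = sup_x (⟨x*, x⟩ - h(x))`. -/
def conj {X : Type*} [AddCommGroup X] [Module ℝ X] [TopologicalSpace X]
    (h : X → EReal) (xs : MackeyDual X) : EReal :=
  ⨆ x : X, ((xs x : ℝ) : EReal) - h x

/-- Quasicontinuity of an extended-real-valued (convex) function `g` on a topological vector
space `E`:
the affine hull of `dom g` is closed and of finite codimension, the interior of `dom g` relative to
its affine hull is nonempty, and the restriction of `g` to the affine hull of `dom g` is continuous
at each point of this relative interior. -/
structure IsQuasicontinuous {E : Type*} [AddCommGroup E] [Module ℝ E] [TopologicalSpace E]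
    (g : E → EReal) : Prop where
  isClosed_aff : IsClosed (affineSpan ℝ (dom g) : Set E)
  finite_codim : FiniteDimensional ℝ (E ⧸ (affineSpan ℝ (dom g)).direction)
  ri_nonempty : (intrinsicInterior ℝ (dom g)).Nonempty
  continuousOn_ri : ∀ x ∈ intrinsicInterior ℝ (dom g),
    ContinuousWithinAt g (affineSpan ℝ (dom g) : Set E) x

/-! ### The optimization problem and its duals

The data are the objective `f` and the constraint functions `c t`, `t ∈ T`, of the problem
`(P)`: minimize `f x` subject to `c t x ≤ 0` for all `t ∈ T`. -/

/-- The feasible set `E` of `(P)`. -/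
def feasibleSet {X T : Type*} (c : T → X → EReal) : Set X := {x | ∀ t, c t x ≤ 0}

/-- The optimal value `inf (P)`. -/
def primalValue {X T : Type*} (f : X → EReal) (c : T → X → EReal) : EReal :=
  ⨅ x ∈ feasibleSet c, f x

/-- The set `sol (P)` of optimal solutions of `(P)`. -/
def solutionSet {X T : Type*} (f : X → EReal) (c : T → X → EReal) : Set X :=
  {x | x ∈ feasibleSet c ∧ ∀ y ∈ feasibleSet c, f x ≤ f y}

/-- The recession cone `(P)_∞` of `(P)`. -/
def problemRecessionCone {X T : Type*} [AddCommGroup X] [Module ℝ X]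
    (f : X → EReal) (c : T → X → EReal) : Set X :=
  {x | (∀ t, recessionFunction (c t) x ≤ 0) ∧ recessionFunction f x ≤ 0}

/-- The function `f + ∑_{t ∈ H} μ_t f_t`. In `EReal` one has `0 * ⊤ = 0`. -/
def lagrangian {X T : Type*} (f : X → EReal) (c : T → X → EReal)
    (H : Finset T) (μ : H → ℝ≥0) (x : X) : EReal :=
  f x + ∑ t : H, ((μ t : ℝ) : EReal) * c t x

/-- `𝓗` is a nonempty family of nonempty finite subsets of `T`, and it covers `T`. -/
structure IsCoveringFamily {T : Type*} (𝓗 : Set (Finset T)) : Prop where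
  nonempty : 𝓗.Nonempty
  nonempty_of_mem : ∀ H ∈ 𝓗, H.Nonempty
  covers : ∀ t : T, ∃ H ∈ 𝓗, t ∈ H

/-- The optimal value `sup (D_𝓗)` of the `𝓗`-dual problem. -/
def dualValue {X T : Type*} (f : X → EReal) (c : T → X → EReal) (𝓗 : Set (Finset T)) : EReal :=
  ⨆ H ∈ 𝓗, ⨆ μ : H → ℝ≥0, ⨅ x : X, lagrangian f c H μ x

/-- The function `φ_𝓗 = inf_{H ∈ 𝓗, μ ∈ ℝ₊^H} (f + ∑_{t ∈ H} μ_t f_t)*` on the dual space. -/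
def phi {X T : Type*} [AddCommGroup X] [Module ℝ X] [TopologicalSpace X]
    (f : X → EReal) (c : T → X → EReal) (𝓗 : Set (Finset T)) (xs : MackeyDual X) : EReal :=
  ⨅ H ∈ 𝓗, ⨅ μ : H → ℝ≥0, conj (lagrangian f c H μ) xs

end

end ConvexInfinite

/-! Write φ for `phi f c 𝓗`. The Lagrangians have supremum f on the feasible set and +∞ off it, and
each is the supremum of its continuous affine minorants (`IsGamma.le_of_forall_minorant`). Hence φ*
is f plus the indicator of the feasible set, while -φ(0) is the dual value. So as soon as φ has a
finite value and a subgradient at 0, its subgradients there are exactly the solutions of (P), and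
there is no duality gap.

The same computation along rays shows that (P)_∞ is the negative polar cone of dom φ. If it is a
linear subspace, it is orthogonal to dom φ. Functionals continuous for the Mackey topology are
points of X (`exists_eq_eval`), so a separation argument puts 0 in the relative interior of dom φ
(`IsQuasicontinuous.zero_mem_intrinsicInterior`).

Quasicontinuity now makes φ continuous at 0 relative to the subspace M spanned by dom φ.
Subgradients therefore exist and, modulo the annihilator of M, lie in one weakly compact set
(`exists_subgradient_and_compact`). That annihilator is finite-dimensional because M has finite
codimension. -/

namespace ConvexInfinite

open Filter Topology

/-! ### Lagrangians as lower semicontinuous proper convex functions -/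

section Sums

theorem exists_real_add_eq_of_add_le {u v : EReal} {a : ℝ} (hu : u ≠ ⊥) (hv : v ≠ ⊥)
    (h : u + v ≤ a) : ∃ p q : ℝ, u ≤ p ∧ v ≤ q ∧ p + q = a := by
  induction u with
  | bot => exact absurd rfl hu
  | top => simp [EReal.top_add_of_ne_bot hv] at h
  | coe p =>
    refine ⟨p, a - p, le_rfl, ?_, by ring⟩
    induction v with
    | bot => exact absurd rfl hv
    | top => simp at h
    | coe q =>
      have : p + q ≤ a := by exact_mod_cast h
      exact_mod_cast (by linarith : q ≤ a - p)

variable {X T : Type*} [AddCommGroup X] [Module ℝ X] [TopologicalSpace X]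

theorem IsGamma.add {h k : X → EReal} (hh : IsGamma h) (hk : IsGamma k) {x₀ : X}
    (h₀ : h x₀ < ⊤) (k₀ : k x₀ < ⊤) : IsGamma fun x => h x + k x where
  convex := by
    rintro ⟨x, a⟩ hx ⟨y, b⟩ hy s t hs ht hst
    obtain ⟨p, q, hp, hq, rfl⟩ := exists_real_add_eq_of_add_le (hh.ne_bot x) (hk.ne_bot x) hx
    obtain ⟨p', q', hp', hq', rfl⟩ := exists_real_add_eq_of_add_le (hh.ne_bot y) (hk.ne_bot y) hy
    have e₁ : h (s • x + t • y) ≤ ((s * p + t * p' : ℝ) : EReal) :=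
      @hh.convex (x, p) hp (y, p') hp' s t hs ht hst
    have e₂ : k (s • x + t • y) ≤ ((s * q + t * q' : ℝ) : EReal) :=
      @hk.convex (x, q) hq (y, q') hq' s t hs ht hst
    refine (add_le_add e₁ e₂).trans ?_
    change _ ≤ ((s * (p + q) + t * (p' + q') : ℝ) : EReal)
    exact_mod_cast (by linarith : s * p + t * p' + (s * q + t * q') ≤ s * (p + q) + t * (p' + q'))
  lsc := hh.lsc.add' hk.lsc fun x =>
    EReal.continuousAt_add (Or.inr (hk.ne_bot x)) (Or.inl (hh.ne_bot x))
  dom_nonempty := ⟨x₀, EReal.add_lt_top h₀.ne k₀.ne⟩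
  ne_bot x := EReal.add_ne_bot_iff.2 ⟨hh.ne_bot x, hk.ne_bot x⟩

theorem isGamma_zero : IsGamma fun _ : X => (0 : EReal) where
  convex := by
    rintro ⟨x, a⟩ hx ⟨y, b⟩ hy s t hs ht hst
    have ha : 0 ≤ a := EReal.coe_nonneg.1 hx
    have hb : 0 ≤ b := EReal.coe_nonneg.1 hy
    change (0 : EReal) ≤ ((s * a + t * b : ℝ) : EReal)
    exact_mod_cast (by positivity : 0 ≤ s * a + t * b)
  lsc := lowerSemicontinuous_const
  dom_nonempty := ⟨0, EReal.zero_lt_top⟩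
  ne_bot _ := EReal.zero_ne_bot

theorem mul_le_coe_iff {μ : ℝ} (hμ : 0 < μ) {u : EReal} {a : ℝ} :
    (μ : EReal) * u ≤ a ↔ u ≤ ((a / μ : ℝ) : EReal) := by
  induction u with
  | bot => simp [EReal.coe_mul_bot_of_pos hμ]
  | top => simp [EReal.coe_mul_top_of_pos hμ]
  | coe p =>
    rw [← EReal.coe_mul, EReal.coe_le_coe_iff, EReal.coe_le_coe_iff, le_div_iff₀ hμ, mul_comm]

theorem IsGamma.const_mul {k : X → EReal} (hk : IsGamma k) (μ : ℝ≥0) :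
    IsGamma fun x => ((μ : ℝ) : EReal) * k x := by
  -- With 0 * ⊤ = 0, the zero multiplier gives the zero function, not the indicator of the domain.
  obtain rfl | hμ := eq_or_ne μ 0
  · simpa using isGamma_zero (X := X)
  have hμ : 0 < (μ : ℝ) := NNReal.coe_pos.2 (pos_iff_ne_zero.2 hμ)
  have hne : ∀ x, ((μ : ℝ) : EReal) * k x ≠ ⊥ := fun x hx => by
    have := hk.ne_bot x
    generalize k x = u at hx this
    induction u with
    | bot => exact this rfl
    | top => simp [EReal.coe_mul_top_of_pos hμ] at hx
    | coe p => exact EReal.coe_ne_bot (μ * p) (by exact_mod_cast hx)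
  refine ⟨?_, ?_, ?_, hne⟩
  · rintro ⟨x, a⟩ hx ⟨y, b⟩ hy s t hs ht hst
    have e : k (s • x + t • y) ≤ ((s * (a / μ) + t * (b / μ) : ℝ) : EReal) :=
      @hk.convex (x, a / μ) ((mul_le_coe_iff hμ).1 hx) (y, b / μ) ((mul_le_coe_iff hμ).1 hy)
        s t hs ht hst
    change ((μ : ℝ) : EReal) * k (s • x + t • y) ≤ ((s * a + t * b : ℝ) : EReal)
    rw [mul_le_coe_iff hμ]
    convert e using 2
    ring
  · refine Continuous.comp_lowerSemicontinuous (g := fun z : EReal => ((μ : ℝ) : EReal) * z)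
      ?_ hk.lsc ?_
    · exact continuous_iff_continuousAt.2 fun z => EReal.Tendsto.const_mul tendsto_id
        (Or.inl (EReal.coe_ne_bot _))
        (Or.inl (EReal.coe_ne_top _))
    · exact fun a b hab => mul_le_mul_of_nonneg_left hab (by exact_mod_cast hμ.le)
  · obtain ⟨x, hx⟩ := hk.dom_nonempty
    refine ⟨x, ?_⟩
    obtain ⟨r, hr⟩ : ∃ r : ℝ, k x = r := ⟨_, (EReal.coe_toReal (ne_of_lt hx) (hk.ne_bot x)).symm⟩
    change ((μ : ℝ) : EReal) * k x < ⊤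
    rw [hr, ← EReal.coe_mul]
    exact EReal.coe_lt_top _

theorem lagrangian_le {E I : Type*} {f : E → EReal} {c : I → E → EReal} {x : E} (hx : x ∈ feasibleSet c)
    (H : Finset I) (μ : H → ℝ≥0) : lagrangian f c H μ x ≤ f x := by
  have : ∑ t : H, ((μ t : ℝ) : EReal) * c t x ≤ 0 :=
    Finset.sum_nonpos fun t _ =>
      EReal.mul_nonpos_iff.2 (Or.inl ⟨by exact_mod_cast (μ t).2, hx t⟩)
  simpa [lagrangian] using add_le_add_right this (f x)

theorem isGamma_lagrangian {f : X → EReal} {c : T → X → EReal} (hf : IsGamma f)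
    (hc : ∀ t, IsGamma (c t)) {x₀ : X} (hx₀ : x₀ ∈ feasibleSet c) (hfx₀ : f x₀ < ⊤)
    (H : Finset T) (μ : H → ℝ≥0) : IsGamma (lagrangian f c H μ) := by
  classical
  have nonpos : ∀ t : H, ((μ t : ℝ) : EReal) * c t x₀ ≤ 0 := fun t =>
    EReal.mul_nonpos_iff.2 (Or.inl ⟨by exact_mod_cast (μ t).2, hx₀ t⟩)
  have key : ∀ S : Finset H, IsGamma fun x => ∑ t ∈ S, ((μ t : ℝ) : EReal) * c t x := by
    intro S
    induction S using Finset.induction_on with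
    | empty => simpa using isGamma_zero (X := X)
    | insert t S ht ih =>
      simp only [Finset.sum_insert ht]
      exact ((hc t).const_mul (μ t)).add ih ((nonpos t).trans_lt EReal.zero_lt_top)
        ((Finset.sum_nonpos fun t _ => nonpos t).trans_lt EReal.zero_lt_top)
  exact hf.add (key Finset.univ) hfx₀
    ((Finset.sum_nonpos fun t _ => nonpos t).trans_lt EReal.zero_lt_top)

/-- The functions `f + ∑ μ_t c_t` have supremum `f` on the feasible set and `⊤` elsewhere. -/
theorem mem_feasibleSet_of_lagrangian_le {E I : Type*} {f : E → EReal} {c : I → E → EReal}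
    {𝓗 : Set (Finset I)} (hcov : IsCoveringFamily 𝓗) {x : E} {a : ℝ} (hfx : f x ≠ ⊥)
    (h : ∀ H ∈ 𝓗, ∀ μ : H → ℝ≥0, lagrangian f c H μ x ≤ a) :
    x ∈ feasibleSet c ∧ f x ≤ a := by
  classical
  have hfa : f x ≤ a := by
    obtain ⟨H, hH⟩ := hcov.nonempty
    simpa [lagrangian] using h H hH 0
  refine ⟨fun t => ?_, hfa⟩
  obtain ⟨H, hH, ht⟩ := hcov.covers t
  obtain ⟨b, hb⟩ : ∃ b : ℝ, f x = b :=
    ⟨_, (EReal.coe_toReal (hfa.trans_lt (EReal.coe_lt_top a)).ne hfx).symm⟩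
  have hn : ∀ n : ℝ≥0, ((b : ℝ) : EReal) + ((n : ℝ) : EReal) * c t x ≤ a := by
    intro n
    -- Only the constraint t is weighted; letting its weight n grow forces `c t x ≤ 0`.
    have := h H hH (Pi.single ⟨t, ht⟩ n)
    rwa [lagrangian, Finset.sum_eq_single ⟨t, ht⟩ (fun s _ hs => by simp [Pi.single_eq_of_ne hs])
      (by simp), Pi.single_eq_same, hb] at this
  generalize c t x = u at hn
  induction u with
  | bot => exact bot_le
  | top => simpa using hn 1
  | coe r =>
    have hn' : ∀ n : ℝ≥0, b + n * r ≤ a := fun n => by exact_mod_cast hn n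
    by_contra hr
    have hr : 0 < r := by
      by_contra h'
      exact hr (by exact_mod_cast not_lt.1 h')
    have hba : b ≤ a := by simpa using hn' 0
    have := hn' ⟨(a - b + 1) / r, by apply div_nonneg <;> linarith⟩
    change b + (a - b + 1) / r * r ≤ a at this
    rw [div_mul_cancel₀ _ hr.ne'] at this
    linarith

end Sums

/-! ### Recession directions and affine minorants -/

section Closed

variable {X : Type*} [AddCommGroup X] [Module ℝ X] [TopologicalSpace X]

theorem IsGamma.isClosed_epi {h : X → EReal} (hh : IsGamma h) : IsClosed (epi h) :=
  hh.lsc.isClosed_epigraph.preimage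
    (f := fun p : X × ℝ => (p.1, (p.2 : EReal)))
    (continuous_fst.prodMk (continuous_coe_real_ereal.comp continuous_snd))

theorem IsGamma.coe_le_of_forall {h : X → EReal} (hh : IsGamma h) {y : X} {v : ℝ}
    (H : ∀ r : ℝ, h y ≤ r → v ≤ r) : (v : EReal) ≤ h y := by
  have := hh.ne_bot y
  generalize h y = w at *
  induction w with
  | bot => exact absurd rfl this
  | top => exact le_top
  | coe r => exact_mod_cast H r le_rfl

/-- A direction of recession of a closed convex set can be detected at a single point. -/
theorem mem_recessionCone_of_ray {E : Type*} [AddCommGroup E] [Module ℝ E] [TopologicalSpace E]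
    [IsTopologicalAddGroup E] [ContinuousSMul ℝ E] {C : Set E} (hC : Convex ℝ C)
    (hcl : IsClosed C) {a₀ d : E} (h : ∀ r : ℝ, 0 ≤ r → a₀ + r • d ∈ C) :
    d ∈ recessionCone C := by
  intro a ha r hr
  -- Mix `a` with the far point `a₀ + (r / s) • d` in proportion s; as s → 0 the mixture tends to `a
  -- + r • d`.
  have hmem : ∀ᶠ s in 𝓝[>] (0 : ℝ), (1 - s) • a + s • a₀ + r • d ∈ C := by
    filter_upwards [Ioo_mem_nhdsGT (zero_lt_one' ℝ)] with s hs
    have := hC ha (h (r / s) (div_nonneg hr hs.1.le)) (sub_nonneg.2 hs.2.le) hs.1.le (by ring)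
    rwa [smul_add, smul_smul, mul_div_cancel₀ _ hs.1.ne', ← add_assoc] at this
  have hcont : Continuous fun s : ℝ => (1 - s) • a + s • a₀ + r • d := by fun_prop
  refine hcl.mem_of_tendsto ?_ hmem
  simpa using (hcont.tendsto 0).mono_left nhdsWithin_le_nhds

theorem IsGamma.recessionFunction_nonpos [IsTopologicalAddGroup X] [ContinuousSMul ℝ X]
    {h : X → EReal} (hh : IsGamma h) {x₀ d : X} {a : ℝ}
    (hr : ∀ r : ℝ, 0 ≤ r → h (x₀ + r • d) ≤ a) : recessionFunction h d ≤ 0 := by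
  have : (d, (0 : ℝ)) ∈ recessionCone (epi h) :=
    mem_recessionCone_of_ray hh.convex hh.isClosed_epi (a₀ := (x₀, a)) fun r h0 => by
      simpa [epi] using hr r h0
  rw [← epi_recessionFunction] at this
  simpa [epi] using this

theorem apply_add_smul_le_of_recessionFunction_nonpos {E : Type*} [AddCommGroup E] [Module ℝ E]
    {h : E → EReal} {d x : E}
    (hd : recessionFunction h d ≤ 0) {a : ℝ} (hx : h x ≤ a) {r : ℝ} (hr : 0 ≤ r) :
    h (x + r • d) ≤ a := by
  have hd' : (d, (0 : ℝ)) ∈ epi (recessionFunction h) := by simpa [epi] using hd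
  rw [epi_recessionFunction] at hd'
  simpa [epi] using hd' (x, a) hx r hr

variable [IsTopologicalAddGroup X] [ContinuousSMul ℝ X] [LocallyConvexSpace ℝ X]

/-- Hahn-Banach applied to the closed convex epigraph. The sign of α comes from the epigraph being
unbounded upwards; α = 0 is a vertical hyperplane. -/
theorem IsGamma.exists_separation {h : X → EReal} (hh : IsGamma h) {x : X} {m : ℝ}
    (hm : ¬ h x ≤ m) : ∃ (F : X →L[ℝ] ℝ) (α u : ℝ), 0 ≤ α ∧ F x - α * m > u ∧
      ∀ y, ∀ r : ℝ, h y ≤ r → F y - α * r ≤ u := by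
  obtain ⟨G, u, hG, hu⟩ := geometric_hahn_banach_closed_point (E := X × ℝ)
    (x := (x, m)) hh.convex hh.isClosed_epi hm
  have hdec : ∀ y r, G (y, r) = G (y, 0) + G (0, 1) * r := fun y r => by
    have : (y, r) = (y, 0) + r • ((0 : X), (1 : ℝ)) := by simp
    rw [this, map_add, map_smul, smul_eq_mul, mul_comm]
  refine ⟨G.comp (ContinuousLinearMap.inl ℝ X ℝ), -G (0, 1), u, ?_, ?_, ?_⟩
  · obtain ⟨y, hy⟩ := hh.dom_nonempty
    obtain ⟨b, hb⟩ : ∃ b : ℝ, h y = b := ⟨_, (EReal.coe_toReal hy.ne (hh.ne_bot y)).symm⟩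
    by_contra hneg
    have hpos : 0 < G (0, 1) := by linarith
    have hmem : (y, max b ((u - G (y, 0)) / G (0, 1))) ∈ epi h := by
      change h y ≤ _
      rw [hb]
      exact_mod_cast le_max_left _ _
    have h1 := hG _ hmem
    rw [hdec] at h1
    have h2 := mul_le_mul_of_nonneg_left (le_max_right b ((u - G (y, 0)) / G (0, 1))) hpos.le
    rw [mul_div_cancel₀ _ hpos.ne'] at h2
    linarith
  · have := hu
    rw [hdec] at this
    simp only [ContinuousLinearMap.comp_apply, ContinuousLinearMap.inl_apply]
    linarith
  · intro y r hr
    have := hG (y, r) hr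
    rw [hdec] at this
    simp only [ContinuousLinearMap.comp_apply, ContinuousLinearMap.inl_apply]
    linarith

/-- A form of the Fenchel-Moreau theorem: a lower semicontinuous proper convex function is the
supremum of its continuous affine minorants. -/
theorem IsGamma.le_of_forall_minorant {h : X → EReal} (hh : IsGamma h) {x : X} {m : ℝ}
    (H : ∀ (F : X →L[ℝ] ℝ) (s : ℝ), (∀ y, ((F y - s : ℝ) : EReal) ≤ h y) → F x - s ≤ m) :
    h x ≤ m := by
  have of_pos : ∀ {z : X} {b : ℝ} {F : X →L[ℝ] ℝ} {α u : ℝ}, 0 < α → F z - α * b > u →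
      (∀ y, ∀ r : ℝ, h y ≤ r → F y - α * r ≤ u) →
      ∃ (F : X →L[ℝ] ℝ) (s : ℝ), (∀ y, ((F y - s : ℝ) : EReal) ≤ h y) ∧ b < F z - s := by
    intro z b F α u hα hz hF
    refine ⟨α⁻¹ • F, α⁻¹ * u, fun y => hh.coe_le_of_forall fun r hr => ?_, ?_⟩
    · have := mul_le_mul_of_nonneg_left (hF y r hr) (inv_pos.2 hα).le
      rw [mul_sub, inv_mul_cancel_left₀ hα.ne'] at this
      simp only [_root_.smul_apply, smul_eq_mul]
      linarith
    · have := mul_lt_mul_of_pos_left hz (inv_pos.2 hα)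
      rw [mul_sub, inv_mul_cancel_left₀ hα.ne'] at this
      simp only [_root_.smul_apply, smul_eq_mul]
      linarith
  by_contra hm
  obtain ⟨F, α, u, hα, hx, hF⟩ := hh.exists_separation hm
  obtain hα | rfl := hα.lt_or_eq
  · obtain ⟨G, s, hG, hlt⟩ := of_pos hα hx hF
    exact absurd (H G s hG) (not_le.2 hlt)
  -- Vertical case: F - u is nonpositive on dom h and positive at x. Adding a large multiple of it
  -- to any affine minorant keeps a minorant and exceeds m at x.
  simp only [zero_mul, sub_zero] at hx hF
  obtain ⟨y, hy⟩ := hh.dom_nonempty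
  obtain ⟨b, hb⟩ : ∃ b : ℝ, h y = b := ⟨_, (EReal.coe_toReal hy.ne (hh.ne_bot y)).symm⟩
  obtain ⟨F', α', u', hα', hx', hF'⟩ := hh.exists_separation (x := y) (m := b - 1) (by
    rw [hb, not_le]
    exact_mod_cast sub_one_lt b)
  -- A hyperplane separating (y, b - 1) from the epigraph point (y, b) cannot be vertical.
  have hα' : 0 < α' := by
    have := hF' y b hb.le
    nlinarith
  obtain ⟨G, s, hG, -⟩ := of_pos hα' hx' hF'
  set k : ℝ := |m - (G x - s)| / (F x - u) with hk
  have hpos : 0 < F x - u := by linarith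
  have hk0 : 0 ≤ k := div_nonneg (abs_nonneg _) hpos.le
  have := H (G + (k + 1) • F) (s + (k + 1) * u) fun y => hh.coe_le_of_forall fun r hr => by
    have h1 : G y - s ≤ r := by exact_mod_cast (hG y).trans hr
    have h2 := hF y r hr
    simp only [_root_.add_apply, _root_.smul_apply, smul_eq_mul]
    nlinarith
  simp only [_root_.add_apply, _root_.smul_apply, smul_eq_mul] at this
  have hk' : k * (F x - u) = |m - (G x - s)| := div_mul_cancel₀ _ hpos.ne'
  nlinarith [le_abs_self (m - (G x - s))]

end Closed

/-! ### The Mackey topology and its continuous functionals -/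

section Mackey

variable {X : Type*} [AddCommGroup X] [Module ℝ X] [TopologicalSpace X]

theorem continuous_eval_weakSpace (xs : MackeyDual X) :
    Continuous fun x : WeakSpace ℝ X => xs ((toWeakSpace ℝ X).symm x) :=
  WeakBilin.eval_continuous (topDualPairing ℝ X).flip
    ((ContinuousLinearMap.toUniformConvergenceCLM _ _ _).symm xs)

/-- A functional on a subspace `M` of the dual that is at most `1` on the trace of the polar of an
absolutely convex weakly compact set `K` is the evaluation at a point of `K`. -/
theorem exists_mem_eq_eval {M : Submodule ℝ (MackeyDual X)} (F : M →ₗ[ℝ] ℝ) {K : Set X}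
    (hK : AbsConvex ℝ K) (hKc : IsCompact (toWeakSpace ℝ X '' K)) (hne : K.Nonempty)
    (hF : ∀ xs : M, (∀ k ∈ K, |(xs : MackeyDual X) k| ≤ 1) → F xs ≤ 1) :
    ∃ k ∈ K, ∀ xs : M, F xs = (xs : MackeyDual X) k := by
  -- The identity pairing gives the algebraic dual of M the topology of pointwise convergence on M.
  -- There the image of K is compact, hence closed, and continuous functionals are evaluations at
  -- elements of M.
  let B : Module.Dual ℝ M →ₗ[ℝ] M →ₗ[ℝ] ℝ := LinearMap.id
  let ev : X →ₗ[ℝ] WeakBilin B :=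
    { toFun := fun x =>
        ({ toFun := fun xs => (xs : MackeyDual X) x
           map_add' := fun _ _ => rfl
           map_smul' := fun _ _ => rfl } : M →ₗ[ℝ] ℝ)
      map_add' := fun x y => LinearMap.ext fun xs => map_add (xs : MackeyDual X) x y
      map_smul' := fun r x => LinearMap.ext fun xs => map_smul (xs : MackeyDual X) r x }
  have hev : Continuous fun x : WeakSpace ℝ X => ev ((toWeakSpace ℝ X).symm x) :=
    WeakBilin.continuous_of_continuous_eval B fun xs => continuous_eval_weakSpace xs.1
  have hinj : Function.Injective B := fun _ _ h => h
  have : T2Space (WeakBilin B) := (WeakBilin.isEmbedding hinj).t2Space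
  have hcomp : IsCompact (ev '' K) := by
    have := hKc.image hev
    rwa [Set.image_image] at this
  by_contra hcon
  have hnot : (F : WeakBilin B) ∉ ev '' K := by
    rintro ⟨k, hk, hkF⟩
    exact hcon ⟨k, hk, fun xs => (LinearMap.congr_fun hkF xs).symm⟩
  obtain ⟨ℓ, u, hℓ, hu⟩ := geometric_hahn_banach_closed_point (hK.2.linear_image ev)
    hcomp.isClosed hnot
  obtain ⟨xs, rfl⟩ := LinearMap.dualEmbedding_surjective B ℓ
  have hlt : ∀ k ∈ K, (xs : MackeyDual X) k < u := fun k hk => hℓ _ ⟨k, hk, rfl⟩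
  have hu : u < F xs := hu
  have h0 : (0 : X) ∈ K := hK.1.zero_mem hne
  have hu0 : 0 < u := by simpa using hlt 0 h0
  -- Since K is balanced, xs < u on K gives |xs| ≤ u there, so `u⁻¹ • xs` lies in the polar of K.
  have := hF (u⁻¹ • xs) fun k hk => by
    have h1 := hlt k hk
    have h2 := hlt (-k) (hK.1.neg_mem_iff.2 hk)
    rw [map_neg] at h2
    have e : ((u⁻¹ • xs : M) : MackeyDual X) k = u⁻¹ * (xs : MackeyDual X) k := rfl
    rw [e, abs_mul, abs_of_pos (inv_pos.2 hu0), inv_mul_le_iff₀ hu0, mul_one]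
    exact abs_le.2 ⟨by linarith, h1.le⟩
  rw [map_smul, smul_eq_mul, inv_mul_le_iff₀ hu0] at this
  linarith

variable (X) in
theorem mackey_family_nonempty :
    {K : Set X | AbsConvex ℝ K ∧ IsCompact (toWeakSpace ℝ X '' K)}.Nonempty :=
  ⟨∅, ⟨balanced_empty, convex_empty⟩, by simp⟩

theorem absConvex_add {E : Type*} [AddCommGroup E] [Module ℝ E] {K L : Set E} (hK : AbsConvex ℝ K) (hL : AbsConvex ℝ L) :
    AbsConvex ℝ (K + L) :=
  ⟨hK.1.add hL.1, hK.2.add hL.2⟩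

variable (X) in
-- For nonempty members, K + L is an upper bound, since each contains 0.
theorem mackey_family_directed :
    DirectedOn (· ⊆ ·) {K : Set X | AbsConvex ℝ K ∧ IsCompact (toWeakSpace ℝ X '' K)} := by
  rintro K ⟨hK, hKc⟩ L ⟨hL, hLc⟩
  obtain rfl | hKne := K.eq_empty_or_nonempty
  · exact ⟨L, ⟨hL, hLc⟩, Set.empty_subset _, subset_rfl⟩
  obtain rfl | hLne := L.eq_empty_or_nonempty
  · exact ⟨K, ⟨hK, hKc⟩, subset_rfl, Set.empty_subset _⟩
  refine ⟨K + L, ⟨absConvex_add hK hL, ?_⟩, fun x hx => ?_, fun x hx => ?_⟩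
  · rw [Set.image_add]
    exact hKc.add hLc
  · exact ⟨x, hx, 0, hL.1.zero_mem hLne, add_zero x⟩
  · exact ⟨0, hK.1.zero_mem hKne, x, hx, zero_add x⟩

instance : LocallyConvexSpace ℝ (MackeyDual X) :=
  UniformConvergenceCLM.locallyConvexSpace ℝ _ (mackey_family_nonempty X)
    (mackey_family_directed X)

instance : ContinuousSMul ℝ (MackeyDual X) := by
  let φ : MackeyDual X →ₗ[ℝ] X → ℝ := ⟨⟨DFunLike.coe, fun _ _ => rfl⟩, fun _ _ => rfl⟩
  refine UniformOnFun.continuousSMul_induced_of_image_bounded ℝ X ℝ (MackeyDual X) φ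
    (UniformConvergenceCLM.isEmbedding_coeFn (RingHom.id ℝ) ℝ _).isInducing
    fun xs K hK => ?_
  have := hK.2.image (continuous_eval_weakSpace xs)
  rw [Set.image_image] at this
  exact this.isVonNBounded ℝ

/-- The polars of the nonempty absolutely convex weakly compact sets form a neighbourhood base at
the origin for the Mackey topology. -/
theorem exists_polar_subset {U : Set (MackeyDual X)} (hU : U ∈ 𝓝 0) :
    ∃ K : Set X, AbsConvex ℝ K ∧ IsCompact (toWeakSpace ℝ X '' K) ∧ K.Nonempty ∧
      ∀ xs : MackeyDual X, (∀ k ∈ K, |xs k| ≤ 1) → xs ∈ U := by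
  obtain ⟨⟨K, ε⟩, ⟨⟨hK, hKc⟩, hε⟩, hKU⟩ := (UniformConvergenceCLM.hasBasis_nhds_zero_of_basis
    (RingHom.id ℝ) ℝ _ (mackey_family_nonempty X) (mackey_family_directed X)
    Metric.nhds_basis_ball).mem_iff.1 hU
  dsimp only at hK hKc hε hKU
  obtain rfl | hne := K.eq_empty_or_nonempty
  · refine ⟨{0}, ⟨balanced_zero, convex_singleton 0⟩, by simp, by simp, fun xs _ => hKU ?_⟩
    simp
  -- The factor 2 turns the non-strict polar bound into |xs k| ≤ ε / 2 < ε.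
  refine ⟨(2 / ε) • K, ⟨hK.1.smul _, hK.2.smul _⟩, ?_, hne.smul_set, fun xs hxs => hKU ?_⟩
  · rw [image_smul_set]
    exact hKc.smul (2 / ε)
  · intro k hk
    have h1 := hxs _ (Set.smul_mem_smul_set hk)
    rw [map_smul, smul_eq_mul, abs_mul, abs_of_pos (by positivity : 0 < 2 / ε), div_mul_eq_mul_div,
      div_le_one hε] at h1
    rw [mem_ball_zero_iff, Real.norm_eq_abs]
    linarith

/-- The Mackey-Arens theorem, relative to a subspace of the dual. -/
theorem exists_eq_eval {M : Submodule ℝ (MackeyDual X)} (F : M →L[ℝ] ℝ) :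
    ∃ x : X, ∀ xs : M, F xs = (xs : MackeyDual X) x := by
  have hU : F ⁻¹' Set.Iio 1 ∈ 𝓝 (0 : M) :=
    F.continuous.continuousAt.preimage_mem_nhds (by simpa using Iio_mem_nhds (zero_lt_one' ℝ))
  obtain ⟨U, hU, hUF⟩ := (mem_nhds_induced _ _ _).1 hU
  obtain ⟨K, hK, hKc, hne, hKU⟩ := exists_polar_subset hU
  obtain ⟨k, -, hk⟩ := exists_mem_eq_eval F.toLinearMap hK hKc hne
    fun xs hxs => (show F xs < 1 from hUF (hKU _ hxs)).le
  exact ⟨k, hk⟩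

end Mackey

/-! ### Relative interiors and effective domains -/

theorem mem_intrinsicInterior_iff_nhdsWithin {E : Type*} [AddCommGroup E] [Module ℝ E]
    [TopologicalSpace E] {s : Set E} {x : E} :
    x ∈ intrinsicInterior ℝ s ↔
      x ∈ affineSpan ℝ s ∧ s ∈ 𝓝[(affineSpan ℝ s : Set E)] x := by
  rw [mem_intrinsicInterior]
  constructor
  · rintro ⟨y, hy, rfl⟩
    exact ⟨y.2, preimage_coe_mem_nhds_subtype.1 (mem_interior_iff_mem_nhds.1 hy)⟩
  · rintro ⟨hx, hs⟩
    exact ⟨⟨x, hx⟩, mem_interior_iff_mem_nhds.2 (preimage_coe_mem_nhds_subtype.2 hs), rfl⟩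

theorem IsConvexFun.convex_dom {E : Type*} [AddCommGroup E] [Module ℝ E] {g : E → EReal}
    (hg : IsConvexFun g) : Convex ℝ (dom g) := by
  have real : ∀ x ∈ dom g, ∃ a : ℝ, g x ≤ a := fun x hx => by
    obtain ⟨a, ha, -⟩ := EReal.lt_iff_exists_real_btwn.1 (show g x < ⊤ from hx)
    exact ⟨a, ha.le⟩
  intro x hx y hy s t hs ht hst
  obtain ⟨a, ha⟩ := real x hx
  obtain ⟨b, hb⟩ := real y hy
  have : g (s • x + t • y) ≤ ((s * a + t * b : ℝ) : EReal) :=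
    @hg (x, a) ha (y, b) hb s t hs ht hst
  exact this.trans_lt (EReal.coe_lt_top _)

/-! ### Separation and subgradients in the Mackey dual -/

section Dual

variable {X : Type*} [AddCommGroup X] [Module ℝ X] [TopologicalSpace X]

/-- If the polar cone of `dom g` is orthogonal to `dom g`, the origin is in the relative interior
of `dom g`. -/
theorem IsQuasicontinuous.zero_mem_intrinsicInterior {g : MackeyDual X → EReal}
    (hq : IsQuasicontinuous g) (hg : IsConvexFun g)
    (hpol : ∀ x : X, (∀ xs ∈ dom g, xs x ≤ 0) → ∀ xs ∈ dom g, xs x = 0) :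
    (0 : MackeyDual X) ∈ intrinsicInterior ℝ (dom g) := by
  obtain ⟨z, hz⟩ := hq.ri_nonempty
  have hzd : z ∈ dom g := intrinsicInterior_subset hz
  by_cases h0 : (0 : MackeyDual X) ∈ affineSpan ℝ (dom g)
  · set M := (affineSpan ℝ (dom g)).direction with hM
    have hA : (affineSpan ℝ (dom g) : Set (MackeyDual X)) = M := by
      ext xs
      simpa using (AffineSubspace.vsub_right_mem_direction_iff_mem h0 xs).symm
    have hsub : dom g ⊆ M := hA ▸ subset_affineSpan ℝ (dom g)
    let s : Set M := (↑) ⁻¹' dom g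
    have hs : Convex ℝ s := hg.convex_dom.linear_preimage M.subtype
    have hmem : ∀ xs : M, xs ∈ interior s ↔ (xs : MackeyDual X) ∈ intrinsicInterior ℝ (dom g) := by
      intro xs
      rw [mem_intrinsicInterior_iff_nhdsWithin, ← SetLike.mem_coe, hA, mem_interior_iff_mem_nhds]
      exact ⟨fun h => ⟨xs.2, preimage_coe_mem_nhds_subtype.1 h⟩,
        fun h => preimage_coe_mem_nhds_subtype.2 h.2⟩
    by_contra hcon
    obtain ⟨F, hF⟩ := geometric_hahn_banach_open_point hs.interior isOpen_interior
      (x := (0 : M)) (by rw [hmem]; exact hcon)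
    rw [map_zero] at hF
    obtain ⟨x, hx⟩ := exists_eq_eval F
    have hzi : (⟨z, hsub hzd⟩ : M) ∈ interior s := (hmem _).2 hz
    -- F is negative on the interior of s, which is dense in s. So x is in the polar cone, and
    -- `hpol` contradicts F < 0 at z.
    have hle : s ⊆ F ⁻¹' Set.Iic 0 :=
      calc s ⊆ closure s := subset_closure
        _ = closure (interior s) := (hs.closure_interior_eq_closure_of_nonempty_interior
            ⟨_, hzi⟩).symm
        _ ⊆ F ⁻¹' Set.Iic 0 := closure_minimal (fun a ha => (hF a ha).le)
            (isClosed_Iic.preimage F.continuous)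
    have hzero := hpol x (fun xs hxs => by
      have : F ⟨xs, hsub hxs⟩ ≤ 0 := hle (show (⟨xs, hsub hxs⟩ : M) ∈ s from hxs)
      rwa [hx] at this) z hzd
    have := hF _ hzi
    rw [hx] at this
    exact this.ne hzero
  · exfalso
    obtain ⟨F, u, hF, hu⟩ := geometric_hahn_banach_closed_point
      (affineSpan ℝ (dom g)).convex hq.isClosed_aff h0
    rw [map_zero] at hu
    obtain ⟨x, hx⟩ := exists_eq_eval (F.comp (⊤ : Submodule ℝ (MackeyDual X)).subtypeL)
    have hx' : ∀ xs ∈ dom g, xs x < 0 := fun xs hxs => by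
      rw [← hx ⟨xs, trivial⟩]
      exact (hF xs (subset_affineSpan ℝ (dom g) hxs)).trans hu
    exact (hx' z hzd).ne (hpol x (fun xs hxs => (hx' xs hxs).le) z hzd)

/-- The subdifferential at the origin of a convex function that is continuous there relative to a
subspace `M` containing its domain is nonempty, and it is compact modulo the annihilator of `M`. -/
theorem exists_subgradient_and_compact {g : MackeyDual X → EReal} (hg : IsConvexFun g)
    {M : Submodule ℝ (MackeyDual X)} (hcont : ContinuousWithinAt g M 0)
    {v : ℝ} (hv : g 0 = v) :
    ∃ K : Set X, Convex ℝ K ∧ IsCompact (toWeakSpace ℝ X '' K) ∧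
      (∃ k ∈ K, ∀ xs ∈ M, ∀ s : ℝ, g xs ≤ s → v + xs k ≤ s) ∧
      ∀ x : X, (∀ xs ∈ M, ∀ s : ℝ, g xs ≤ s → v + xs x ≤ s) →
        ∃ k ∈ K, ∀ xs ∈ M, xs x = xs k := by
  have hlt : ∀ᶠ xs in 𝓝[(M : Set (MackeyDual X))] 0, g xs < ((v + 1 : ℝ) : EReal) := by
    refine hcont.eventually_lt_const ?_
    rw [hv]
    exact_mod_cast lt_add_one v
  obtain ⟨U, hU, hUg⟩ := mem_nhdsWithin_iff_exists_mem_nhds_inter.1 hlt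
  obtain ⟨K, hK, hKc, hKne, hKU⟩ := exists_polar_subset hU
  -- Where g < v + 1, a subgradient is at most 1; this holds on the trace of the polar of K. No
  -- continuity of F is needed.
  have bound : ∀ F : M →ₗ[ℝ] ℝ, (∀ xs : M, ∀ s : ℝ, g xs ≤ s → v + F xs ≤ s) →
      ∃ k ∈ K, ∀ xs : M, F xs = (xs : MackeyDual X) k := fun F hF =>
    exists_mem_eq_eval F hK hKc hKne fun xs hxs => by
      have := hF xs (v + 1) (show g xs < _ from hUg ⟨hKU xs hxs, xs.2⟩).le
      linarith
  refine ⟨K, hK.2, hKc, ?_, fun x hx => ?_⟩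
  · let s : Set (M × ℝ) := {p | g p.1 ≤ p.2}
    have hs : Convex ℝ s := fun p hp q hq a b ha hb hab =>
      @hg (p.1, p.2) hp (q.1, q.2) hq a b ha hb hab
    have hlt' : ∀ᶠ xs : M in 𝓝 0, g xs < ((v + 1 : ℝ) : EReal) :=
      (preimage_coe_mem_nhds_subtype (s := (M : Set (MackeyDual X)))
        (t := {xs | g xs < ((v + 1 : ℝ) : EReal)}) (a := 0)).2 hlt
    have hint : ((0 : M), v + 2) ∈ interior s := by
      rw [mem_interior_iff_mem_nhds, nhds_prod_eq]
      filter_upwards [prod_mem_prod hlt' (Ioi_mem_nhds (by linarith : v + 1 < v + 2))] with p hp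
      have h1 : g p.1 < ((v + 1 : ℝ) : EReal) := hp.1
      have h2 : v + 1 < p.2 := hp.2
      exact h1.le.trans (by exact_mod_cast h2.le)
    have hnot : ((0 : M), v) ∉ interior s := by
      intro h
      have hc : Continuous fun r : ℝ => ((0 : M), r) := by fun_prop
      have hev := hc.continuousAt.preimage_mem_nhds (x := v) (mem_interior_iff_mem_nhds.1 h)
      obtain ⟨ε, hε, hεs⟩ := Metric.mem_nhds_iff.1 hev
      have hmem : g 0 ≤ ((v - ε / 2 : ℝ) : EReal) := hεs (show v - ε / 2 ∈ Metric.ball v ε by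
        rw [Metric.mem_ball, Real.dist_eq, sub_sub_cancel_left, abs_neg, abs_of_pos (by positivity)]
        linarith)
      rw [hv] at hmem
      have : v ≤ v - ε / 2 := by exact_mod_cast hmem
      linarith
    obtain ⟨G, hG⟩ := geometric_hahn_banach_open_point hs.interior isOpen_interior hnot
    have hdec : ∀ (y : M) (r : ℝ), G (y, r) = G (y, 0) + G (0, 1) * r := fun y r => by
      have : (y, r) = (y, 0) + r • ((0 : M), (1 : ℝ)) := by simp
      rw [this, map_add, map_smul, smul_eq_mul, mul_comm]
    have hle : s ⊆ G ⁻¹' Set.Iic (G (0, v)) :=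
      calc s ⊆ closure s := subset_closure
        _ = closure (interior s) := (hs.closure_interior_eq_closure_of_nonempty_interior
            ⟨_, hint⟩).symm
        _ ⊆ G ⁻¹' Set.Iic (G (0, v)) := closure_minimal (fun a ha => (hG a ha).le)
            (isClosed_Iic.preimage G.continuous)
    have hG0 : G ((0 : M), (0 : ℝ)) = 0 := map_zero G
    -- (0, v + 2) is interior to the epigraph and lies above (0, v), so the hyperplane is not
    -- vertical.
    have hα : 0 < -G (0, 1) := by
      have := hG _ hint
      rw [hdec, hdec 0 v] at this
      linarith
    let F : M →ₗ[ℝ] ℝ := (-G (0, 1))⁻¹ • (G.toLinearMap ∘ₗ LinearMap.inl ℝ M ℝ)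
    have hF : ∀ xs, F xs = (-G (0, 1))⁻¹ * G (xs, 0) := fun _ => rfl
    obtain ⟨k, hk, hkF⟩ := bound F fun xs r hr => by
      have h1 : G (xs, r) ≤ G (0, v) := hle (show (xs, r) ∈ s from hr)
      rw [hdec, hdec 0 v, hG0] at h1
      have h2 : (-G (0, 1))⁻¹ * G (xs, 0) ≤ r - v := by
        rw [inv_mul_le_iff₀ hα]
        linarith
      rw [hF]
      linarith
    refine ⟨k, hk, fun xs hxs r hr => ?_⟩
    have h1 : G (⟨xs, hxs⟩, r) ≤ G (0, v) := hle (show (⟨xs, hxs⟩, r) ∈ s from hr)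
    rw [hdec, hdec 0 v, hG0] at h1
    have h2 : (-G (0, 1))⁻¹ * G (⟨xs, hxs⟩, 0) ≤ r - v := by
      rw [inv_mul_le_iff₀ hα]
      linarith
    have h3 := hkF ⟨xs, hxs⟩
    rw [hF] at h3
    change _ = xs k at h3
    linarith
  · let F : M →ₗ[ℝ] ℝ :=
      { toFun := fun xs => (xs : MackeyDual X) x
        map_add' := fun _ _ => rfl
        map_smul' := fun _ _ => rfl }
    obtain ⟨k, hk, hkF⟩ := bound F fun xs s hs => hx xs xs.2 s hs
    exact ⟨k, hk, fun xs hxs => hkF ⟨xs, hxs⟩⟩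

/-- The annihilator in `X` of a subspace of the dual. -/
def dualCoannihilator (M : Submodule ℝ (MackeyDual X)) : Submodule ℝ X where
  carrier := {x | ∀ xs ∈ M, xs x = 0}
  add_mem' := fun {x y} hx hy xs hxs => by rw [map_add, hx xs hxs, hy xs hxs, add_zero]
  zero_mem' := fun xs _ => map_zero xs
  smul_mem' := fun r x hx xs hxs => by rw [map_smul, hx xs hxs, smul_zero]

/-- Continuous functionals separate the points of X, so this space embeds in the algebraic
annihilator of M, which is the dual of the finite-dimensional quotient. -/
theorem finiteDimensional_dualCoannihilator [IsTopologicalAddGroup X] [ContinuousSMul ℝ X]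
    [LocallyConvexSpace ℝ X] [T2Space X] (M : Submodule ℝ (MackeyDual X))
    [FiniteDimensional ℝ (MackeyDual X ⧸ M)] : FiniteDimensional ℝ (dualCoannihilator M) := by
  let ev : X →ₗ[ℝ] Module.Dual ℝ (MackeyDual X) :=
    { toFun := fun x =>
        { toFun := fun xs => xs x
          map_add' := fun _ _ => rfl
          map_smul' := fun _ _ => rfl }
      map_add' := fun x y => LinearMap.ext fun xs => map_add xs x y
      map_smul' := fun r x => LinearMap.ext fun xs => map_smul xs r x }
  have hev : Function.Injective ev := by
    intro x y hxy
    by_contra hne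
    obtain ⟨F, hF⟩ := geometric_hahn_banach_point_point hne
    exact hF.ne (LinearMap.congr_fun hxy (F.toUniformConvergenceCLM (RingHom.id ℝ) ℝ _))
  have hmaps : ∀ x ∈ dualCoannihilator M, ev x ∈ M.dualAnnihilator := fun x hx =>
    (Submodule.mem_dualAnnihilator _).2 hx
  let r : dualCoannihilator M →ₗ[ℝ] M.dualAnnihilator := ev.restrict hmaps
  have hr : Function.Injective r := fun x y hxy =>
    Subtype.ext (hev (congrArg (fun z : M.dualAnnihilator => z.1) hxy))
  exact FiniteDimensional.of_injective (M.dualQuotEquivDualAnnihilator.symm.toLinearMap ∘ₗ r)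
    (M.dualQuotEquivDualAnnihilator.symm.injective.comp hr)

end Dual

/-! ### Conjugacy between φ and the primal problem -/

section Duality

theorem coe_sub_le_coe_iff {p s : ℝ} {u : EReal} :
    (p : EReal) - u ≤ s ↔ ((p - s : ℝ) : EReal) ≤ u := by
  induction u with
  | bot => simp [-EReal.coe_sub]
  | top => simp
  | coe q =>
    rw [← EReal.coe_sub, EReal.coe_le_coe_iff, EReal.coe_le_coe_iff]
    exact sub_le_comm

variable {X T : Type*} [AddCommGroup X] [Module ℝ X] [TopologicalSpace X]
  {f : X → EReal} {c : T → X → EReal} {𝓗 : Set (Finset T)}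

theorem conj_le_coe_iff {h : X → EReal} {xs : MackeyDual X} {s : ℝ} :
    conj h xs ≤ s ↔ ∀ y, ((xs y - s : ℝ) : EReal) ≤ h y := by
  simp only [conj, iSup_le_iff, coe_sub_le_coe_iff]

theorem exists_minorant_of_phi_lt {xs : MackeyDual X} {s : ℝ} (h : phi f c 𝓗 xs < s) :
    ∃ H ∈ 𝓗, ∃ μ : H → ℝ≥0, ∀ y, ((xs y - s : ℝ) : EReal) ≤ lagrangian f c H μ y := by
  simp only [phi, iInf_lt_iff] at h
  obtain ⟨H, hH, μ, hμ⟩ := h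
  exact ⟨H, hH, μ, conj_le_coe_iff.1 hμ.le⟩

theorem phi_le_of_minorant {H : Finset T} (hH : H ∈ 𝓗) {μ : H → ℝ≥0} {xs : MackeyDual X} {s : ℝ}
    (h : ∀ y, ((xs y - s : ℝ) : EReal) ≤ lagrangian f c H μ y) : phi f c 𝓗 xs ≤ s :=
  (iInf₂_le H hH).trans ((iInf_le _ μ).trans (conj_le_coe_iff.2 h))

/-- The Fenchel-Young inequality for `φ_𝓗` and the restriction of `f` to the feasible set. -/
theorem apply_sub_le_of_phi_le {xs : MackeyDual X} {s a : ℝ} (h : phi f c 𝓗 xs ≤ s) {x : X}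
    (hx : x ∈ feasibleSet c) (ha : f x ≤ a) : xs x - s ≤ a := by
  refine le_of_forall_pos_le_add fun ε hε => ?_
  obtain ⟨H, hH, μ, hμ⟩ := exists_minorant_of_phi_lt (s := s + ε)
    (h.trans_lt (by exact_mod_cast lt_add_of_pos_right s hε))
  have : xs x - (s + ε) ≤ a := by
    exact_mod_cast (hμ x).trans ((lagrangian_le hx H μ).trans ha)
  linarith

theorem exists_phi_le {xs : MackeyDual X} (h : xs ∈ dom (phi f c 𝓗)) :
    ∃ s : ℝ, phi f c 𝓗 xs ≤ s := by
  obtain ⟨a, ha, -⟩ := EReal.lt_iff_exists_real_btwn.1 (show phi f c 𝓗 xs < ⊤ from h)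
  exact ⟨a, ha.le⟩

/-- Moving from x₀ along d preserves feasibility and `f ≤ a`, so Fenchel-Young bounds xs above on
the whole ray. With the converse `mem_problemRecessionCone_of_forall_nonpos`, this makes (P)_∞ the
negative polar of dom φ. -/
theorem apply_nonpos_of_mem_problemRecessionCone {x₀ : X} (hx₀ : x₀ ∈ feasibleSet c) {a : ℝ}
    (ha : f x₀ ≤ a) {d : X} (hd : d ∈ problemRecessionCone f c) {xs : MackeyDual X}
    (hxs : xs ∈ dom (phi f c 𝓗)) : xs d ≤ 0 := by
  obtain ⟨s, hs⟩ := exists_phi_le hxs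
  have hr : ∀ r : ℝ, 0 ≤ r → xs x₀ + r * xs d - s ≤ a := fun r hr => by
    have hfeas : x₀ + r • d ∈ feasibleSet c := fun t => by
      have := apply_add_smul_le_of_recessionFunction_nonpos (hd.1 t) (x := x₀) (a := 0)
        (by simpa using hx₀ t) hr
      simpa using this
    have := apply_sub_le_of_phi_le hs hfeas
      (apply_add_smul_le_of_recessionFunction_nonpos hd.2 ha hr)
    rwa [map_add, map_smul, smul_eq_mul] at this
  by_contra hpos
  rw [not_le] at hpos
  have h0 := hr 0 le_rfl
  have h1 := hr ((a + s - xs x₀ + 1) / xs d) (div_nonneg (by linarith) hpos.le)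
  rw [div_mul_cancel₀ _ hpos.ne'] at h1
  linarith

variable [IsTopologicalAddGroup X] [ContinuousSMul ℝ X] [LocallyConvexSpace ℝ X]

/-- The biconjugate bound: `φ_𝓗* ≤ m` at a point forces feasibility and `f ≤ m` there. -/
theorem mem_feasibleSet_of_forall_phi_le (hf : IsGamma f) (hc : ∀ t, IsGamma (c t))
    (hcov : IsCoveringFamily 𝓗) {x₀ : X} (hx₀ : x₀ ∈ feasibleSet c) (hfx₀ : f x₀ < ⊤)
    {x : X} {m : ℝ} (h : ∀ (xs : MackeyDual X) (s : ℝ), phi f c 𝓗 xs ≤ s → xs x - s ≤ m) :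
    x ∈ feasibleSet c ∧ f x ≤ m :=
  mem_feasibleSet_of_lagrangian_le hcov (hf.ne_bot x) fun H hH μ =>
    (isGamma_lagrangian hf hc hx₀ hfx₀ H μ).le_of_forall_minorant fun F s hF =>
      h (F.toUniformConvergenceCLM (RingHom.id ℝ) ℝ _) s (phi_le_of_minorant hH hF)

theorem mem_problemRecessionCone_of_forall_nonpos (hf : IsGamma f) (hc : ∀ t, IsGamma (c t))
    (hcov : IsCoveringFamily 𝓗) {x₀ : X} (hx₀ : x₀ ∈ feasibleSet c) (hfx₀ : f x₀ < ⊤)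
    {d : X} (h : ∀ xs ∈ dom (phi f c 𝓗), xs d ≤ 0) : d ∈ problemRecessionCone f c := by
  obtain ⟨a, ha⟩ : ∃ a : ℝ, f x₀ = a := ⟨_, (EReal.coe_toReal hfx₀.ne (hf.ne_bot x₀)).symm⟩
  have key : ∀ r : ℝ, 0 ≤ r → x₀ + r • d ∈ feasibleSet c ∧ f (x₀ + r • d) ≤ a := fun r hr =>
    mem_feasibleSet_of_forall_phi_le hf hc hcov hx₀ hfx₀ fun xs s hs => by
      have h1 := apply_sub_le_of_phi_le hs hx₀ ha.le
      have h2 := h xs (hs.trans_lt (EReal.coe_lt_top s))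
      rw [map_add, map_smul, smul_eq_mul]
      nlinarith
  exact ⟨fun t => (hc t).recessionFunction_nonpos (x₀ := x₀) (a := 0) fun r hr => by
      simpa using (key r hr).1 t,
    hf.recessionFunction_nonpos fun r hr => (key r hr).2⟩

end Duality

end ConvexInfinite

/-! ### The main theorem -/

open ConvexInfinite in
theorem theorem4 {X T : Type*} [AddCommGroup X] [Module ℝ X] [TopologicalSpace X]
    [IsTopologicalAddGroup X] [ContinuousSMul ℝ X] [LocallyConvexSpace ℝ X] [T2Space X]
    (f : X → EReal) (c : T → X → EReal) (𝓗 : Set (Finset T))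
    (hf : ConvexInfinite.IsGamma f) (hc : ∀ t, ConvexInfinite.IsGamma (c t))
    (hfeas : (ConvexInfinite.feasibleSet c ∩ ConvexInfinite.dom f).Nonempty)
    (hcov : ConvexInfinite.IsCoveringFamily 𝓗)
    (hconv : ConvexInfinite.IsConvexFun (ConvexInfinite.phi f c 𝓗))
    (hquasi : ConvexInfinite.IsQuasicontinuous (ConvexInfinite.phi f c 𝓗))
    (hrec : ∃ L : Submodule ℝ X, (L : Set X) = ConvexInfinite.problemRecessionCone f c) :
    (∃ m : ℝ,
      (∃ x ∈ ConvexInfinite.solutionSet f c, f x = (m : EReal)) ∧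
      ConvexInfinite.primalValue f c = (m : EReal) ∧
      ConvexInfinite.dualValue f c 𝓗 = (m : EReal)) ∧
    ∃ (C : Set X) (V : Submodule ℝ X),
      Convex ℝ C ∧ IsCompact (toWeakSpace ℝ X '' C) ∧ FiniteDimensional ℝ V ∧
      ConvexInfinite.solutionSet f c = C + (V : Set X) := by
  obtain ⟨x₀, hx₀, hfx₀⟩ := hfeas
  obtain ⟨L, hL⟩ := hrec
  obtain ⟨a, ha⟩ : ∃ a : ℝ, f x₀ = a := ⟨_, (EReal.coe_toReal hfx₀.ne (hf.ne_bot x₀)).symm⟩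
  have h0 : (0 : MackeyDual X) ∈ intrinsicInterior ℝ (dom (phi f c 𝓗)) := by
    refine hquasi.zero_mem_intrinsicInterior hconv fun x hx xs hxs => ?_
    have hxL : x ∈ L := by
      rw [← SetLike.mem_coe, hL]
      exact mem_problemRecessionCone_of_forall_nonpos hf hc hcov hx₀ hfx₀ hx
    have hneg : -x ∈ problemRecessionCone f c := hL ▸ L.neg_mem hxL
    have := apply_nonpos_of_mem_problemRecessionCone hx₀ ha.le hneg hxs
    rw [map_neg] at this
    exact le_antisymm (hx xs hxs) (by linarith)
  have h0aff : (0 : MackeyDual X) ∈ affineSpan ℝ (dom (phi f c 𝓗)) :=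
    subset_affineSpan ℝ _ (intrinsicInterior_subset h0)
  set M := (affineSpan ℝ (dom (phi f c 𝓗))).direction with hM
  have hA : (affineSpan ℝ (dom (phi f c 𝓗)) : Set (MackeyDual X)) = M := by
    ext xs
    simpa using (AffineSubspace.vsub_right_mem_direction_iff_mem h0aff xs).symm
  have hsub : ∀ {xs : MackeyDual X} {s : ℝ}, phi f c 𝓗 xs ≤ s → xs ∈ M := fun {xs s} hs => by
    rw [← SetLike.mem_coe, ← hA]
    exact subset_affineSpan ℝ _ (hs.trans_lt (EReal.coe_lt_top s))
  obtain ⟨v, hv⟩ : ∃ v : ℝ, phi f c 𝓗 0 = v := by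
    obtain ⟨s, hs⟩ := exists_phi_le (intrinsicInterior_subset h0)
    refine ⟨_, (EReal.coe_toReal (hs.trans_lt (EReal.coe_lt_top s)).ne fun hbot => ?_).symm⟩
    -- φ(0) = -∞ would allow every real s in Fenchel-Young at x₀; this one yields a + 1 ≤ a.
    have := apply_sub_le_of_phi_le (s := -a - 1) (hbot.le.trans bot_le) hx₀ ha.le
    rw [zero_apply] at this
    linarith
  obtain ⟨K, hK, hKc, ⟨z, hzK, hz⟩, hKS⟩ :=
    exists_subgradient_and_compact hconv (hA ▸ hquasi.continuousOn_ri 0 h0) hv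
  have weak : ∀ y ∈ feasibleSet c, ((-v : ℝ) : EReal) ≤ f y := fun y hy =>
    hf.coe_le_of_forall fun r hr => by
      simpa using apply_sub_le_of_phi_le hv.le hy hr
  have sub_sol : ∀ x, (∀ xs ∈ M, ∀ s : ℝ, phi f c 𝓗 xs ≤ s → v + xs x ≤ s) →
      x ∈ feasibleSet c ∧ f x ≤ ((-v : ℝ) : EReal) := fun x hx =>
    mem_feasibleSet_of_forall_phi_le hf hc hcov hx₀ hfx₀ fun xs s hs => by
      linarith [hx xs (hsub hs) s hs]
  obtain ⟨hzfeas, hzle⟩ := sub_sol z hz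
  -- Solutions are the subgradients of φ at 0: Fenchel-Young one way, the biconjugate bound the
  -- other.
  have sol_iff : ∀ x, x ∈ solutionSet f c ↔
      ∀ xs ∈ M, ∀ s : ℝ, phi f c 𝓗 xs ≤ s → v + xs x ≤ s := by
    refine fun x => ⟨fun hx xs _ s hs => ?_, fun hx => ?_⟩
    · linarith [apply_sub_le_of_phi_le hs hx.1 ((hx.2 z hzfeas).trans hzle)]
    · obtain ⟨hxfeas, hxle⟩ := sub_sol x hx
      exact ⟨hxfeas, fun y hy => hxle.trans (weak y hy)⟩
  have hfz : f z = ((-v : ℝ) : EReal) := le_antisymm hzle (weak z hzfeas)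
  refine ⟨⟨-v, ⟨z, (sol_iff z).2 hz, hfz⟩, ?_, ?_⟩, K ∩ solutionSet f c, dualCoannihilator M,
    ?_, ?_, ?_, ?_⟩
  · exact le_antisymm ((iInf₂_le z hzfeas).trans hzle) (le_iInf₂ weak)
  · refine le_antisymm ?_ (EReal.ge_of_forall_gt_iff_ge.1 fun b hb => ?_)
    · exact iSup₂_le fun H _ => iSup_le fun μ =>
        (iInf_le _ z).trans ((lagrangian_le hzfeas H μ).trans hzle)
    · have hb : b < -v := by exact_mod_cast hb
      obtain ⟨H, hH, μ, hμ⟩ := exists_minorant_of_phi_lt (f := f) (c := c) (𝓗 := 𝓗) (xs := 0)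
        (s := -b) (by rw [hv]; exact_mod_cast (by linarith : v < -b))
      refine le_iSup₂_of_le H hH (le_iSup_of_le μ (le_iInf fun y => ?_))
      simpa using hμ y
  · refine hK.inter fun x hx y hy s t hs ht hst => ?_
    rw [sol_iff] at hx hy ⊢
    intro xs hxs r hr
    have h1 := hx xs hxs r hr
    have h2 := hy xs hxs r hr
    rw [map_add, map_smul, map_smul, smul_eq_mul, smul_eq_mul]
    obtain rfl : s = 1 - t := by linarith
    nlinarith
  -- The subdifferential is an intersection of weakly closed half-spaces.
  · have hcl : IsClosed {w : WeakSpace ℝ X | ∀ xs ∈ M, ∀ s : ℝ, phi f c 𝓗 xs ≤ s →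
        v + xs ((toWeakSpace ℝ X).symm w) ≤ s} := by
      simp only [Set.ofPred_forall]
      exact isClosed_iInter fun xs => isClosed_iInter fun _ => isClosed_iInter fun s =>
        isClosed_iInter fun _ => isClosed_le
          (continuous_const.add (continuous_eval_weakSpace xs)) continuous_const
    convert hKc.inter_right hcl using 1
    ext w
    constructor
    · rintro ⟨x, ⟨hxK, hx⟩, rfl⟩
      exact ⟨⟨x, hxK, rfl⟩, (sol_iff x).1 hx⟩
    · rintro ⟨⟨x, hxK, rfl⟩, hx⟩
      exact ⟨x, ⟨hxK, (sol_iff x).2 hx⟩, rfl⟩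
  · have := hquasi.finite_codim
    exact finiteDimensional_dualCoannihilator M
  · ext x
    constructor
    · intro hx
      rw [sol_iff] at hx
      obtain ⟨k, hkK, hk⟩ := hKS x hx
      -- Being a solution depends only on the values on M, where x and k agree.
      refine ⟨k, ⟨hkK, (sol_iff k).2 fun xs hxs s hs => ?_⟩, x - k, fun xs hxs => ?_,
        add_sub_cancel k x⟩
      · rw [← hk xs hxs]
        exact hx xs hxs s hs
      · rw [map_sub, hk xs hxs, sub_self]
    · rintro ⟨k, ⟨-, hk⟩, y, hy, rfl⟩
      rw [sol_iff] at hk ⊢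
      intro xs hxs s hs
      have : xs y = 0 := hy xs hxs
      change v + xs (k + y) ≤ s
      rw [map_add, this, add_zero]
      exact hk xs hxs s hs
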